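/- Let $\Sigma=\{0,1\}$. A complexity class is any collection of subsets of $\Sigma^*$. A class $\mathcal C$ is closed under disjoint union if $A\oplus B\in\mathcal C$ for all $A,B\in\mathcal C$, where $A\oplus B=\{x0\mid x\in A\}\cup\{x1\mid x\in B\}$. A DPTM is a deterministic oracle Turing machine (here with access to two oracles) whose running time is bounded by a polynomial in the length of the input, the bound being independent of the oracles. For complexity classes $\mathcal C$ and $\mathcal D$, let $\mathrm P^{\mathcal C:\mathcal D}$ be the class of all languages $L\subseteq\Sigma^*$ for which there are $C\in\mathcal C$, $D\in\mathcal D$ and a DPTM $M$ that, with the oracles $C$ and $D$, makes on every input at most one query to $C$ followed by at most one query to $D$, and accepts exactly the strings in $L$. Let $\mathrm P^{\mathcal C,\mathcal D}$ be defined in the same way, except that $M$ makes on every input at most one query to $C$ and at most one query to $D$, in arbitrary (adaptively chosen) order. **Theorem.** If $\mathcal C$ and $\mathcal D$ are complexity classes that are both closed under disjoint union, then $$\mathrm P^{\mathcal C:\mathcal D}=\mathrm P^{\mathcal D:\mathcal C}\ \Longrightarrow\ \mathrm P^{\mathcal C:\mathcal D}=\mathrm P^{\mathcal C,\mathcal D}.$$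 -/

import Mathlib

namespace QueryOrder

/-- What the head on the read-only input tape sees: the left endmarker, an input bit, or the
right endmarker. -/
inductive InSym : Type
  | left
  | bit (b : Bool)
  | right

/-- What a machine with states `Q`, work tapes indexed by `ι` and work alphabet `Γ` does in one
step: an ordinary move, a query to oracle number `o`, or halting.

* `work q inp write dir emit`: go to state `q`, move the input head according to `inp` (`none`
  means stay), write `write i` on work tape `i` and then move its head according to `dir i`,
  and append the bit `emit` (if any) to the write-only query tape.
* `ask o yes no`: ask whether the string on the query tape belongs to oracle number `o`, go to
  state `yes` or `no` according to the answer, and erase the query tape.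
* `halt acc`: halt, accepting iff `acc = true`. -/
inductive Instr (Q ι Γ : Type) : Type
  | work (q : Q) (inp : Option Turing.Dir) (write : ι → Γ) (dir : ι → Option Turing.Dir)
      (emit : Option Bool)
  | ask (o : Fin 2) (yes no : Q)
  | halt (acc : Bool)

/-- Deterministic multi-tape Turing machines with access to two oracles (numbered `0` and `1`):
a read-only input tape with endmarkers, finitely many two-way infinite read-write work tapes
over a finite alphabet whose default element is the blank symbol, and a write-only query
tape. -/
structure OracleTM : Type 1 where
  State : Type
  TapeIdx : Type
  Sym : Type
  [finState : Finite State]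
  [finTapeIdx : Finite TapeIdx]
  [finSym : Finite Sym]
  [blank : Inhabited Sym]
  start : State
  trans : State → InSym → (TapeIdx → Sym) → Instr State TapeIdx Sym

attribute [instance] OracleTM.finState OracleTM.finTapeIdx OracleTM.finSym OracleTM.blank

/-- The symbol in cell `p` of the input tape for input `x`: cell `0` holds the left endmarker,
cells `1, …, |x|` hold `x`, and the next cell holds the right endmarker. -/
def inputAt (x : List Bool) : ℕ → InSym
  | 0 => .left
  | p + 1 => match x[p]? with
    | some b => .bit b
    | none => .right

/-- Moving the input head, which never leaves the cells `0, …, |x| + 1`. -/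
def moveInput (x : List Bool) : Option Turing.Dir → ℕ → ℕ
  | none, p => p
  | some .left, p => p - 1
  | some .right, p => min (p + 1) (x.length + 1)

/-- Moving a work-tape head, or leaving it where it is. -/
def moveTape {Γ : Type} [Inhabited Γ] : Option Turing.Dir → Turing.Tape Γ → Turing.Tape Γ
  | none, T => T
  | some d, T => T.move d

namespace OracleTM

/-- Configurations of `M`. -/
structure Cfg (M : OracleTM) : Type where
  state : M.State
  /-- The position of the head on the input tape. -/
  pos : ℕ
  tapes : M.TapeIdx → Turing.Tape M.Sym
  /-- The string that is currently written on the query tape. -/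
  query : List Bool

variable (M : OracleTM)

/-- The initial configuration: the input head on the left endmarker, blank work tapes, empty
query tape. -/
def init : M.Cfg where
  state := M.start
  pos := 0
  tapes := fun _ => default
  query := []

/-- The instruction that `M` executes next in configuration `c` on input `x`. -/
def instr (x : List Bool) (c : M.Cfg) : Instr M.State M.TapeIdx M.Sym :=
  M.trans c.state (inputAt x c.pos) (fun i => (c.tapes i).head)

open Classical in
/-- One step of `M` on input `x` with the oracles `O 0` and `O 1`; a halted configuration does
not change any more. -/
noncomputable def step (O : Fin 2 → Language Bool) (x : List Bool) (c : M.Cfg) : M.Cfg :=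
  match M.instr x c with
  | .work q inp write dir emit =>
    { state := q
      pos := moveInput x inp c.pos
      tapes := fun i => moveTape (dir i) ((c.tapes i).write (write i))
      query := c.query ++ emit.toList }
  | .ask o yes no =>
    { c with
      state := if c.query ∈ O o then yes else no
      query := [] }
  | .halt _ => c

/-- The configuration of `M` on input `x` with the oracles `O` after `n` steps. -/
noncomputable def run (O : Fin 2 → Language Bool) (x : List Bool) (n : ℕ) : M.Cfg :=
  (M.step O x)^[n] M.init

/-- `M` on input `x` has halted after `n` steps. -/
def HaltsIn (O : Fin 2 → Language Bool) (x : List Bool) (n : ℕ) : Prop :=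
  ∃ acc, M.instr x (M.run O x n) = .halt acc

/-- The number of the oracle that is queried in the next step, if that step is a query. -/
def asked (x : List Bool) (c : M.Cfg) : Option (Fin 2) :=
  match M.instr x c with
  | .ask o _ _ => some o
  | _ => none

/-- The numbers of the oracles that are queried by `M` on input `x` in its first `n` steps, one
entry for each query, in the order of the queries. -/
noncomputable def queries (O : Fin 2 → Language Bool) (x : List Bool) (n : ℕ) : List (Fin 2) :=
  (List.range n).filterMap fun t => M.asked x (M.run O x t)

/-- The language accepted by `M` with the oracles `O`. -/
def accepts (O : Fin 2 → Language Bool) : Language Bool :=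
  {x | ∃ n, M.instr x (M.run O x n) = .halt true}

/-- `M` is a deterministic polynomial-time oracle Turing machine: its running time has a
polynomial bound in the length of the input that does not depend on the oracles. -/
def IsPolyTime : Prop :=
  ∃ p : Polynomial ℕ, ∀ (O : Fin 2 → Language Bool) (x : List Bool),
    M.HaltsIn O x (p.eval x.length)

/-- With the oracles `O`, on every input, `M` makes at most one query to `O 0` followed by at
most one query to `O 1`. -/
def OrderedQueries (O : Fin 2 → Language Bool) : Prop :=
  ∀ x n, (M.queries O x n).Sublist [0, 1]

/-- With the oracles `O`, on every input, `M` makes at most one query to `O 0` and at most one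
query to `O 1`, in arbitrary order. -/
def OnceEachQueries (O : Fin 2 → Language Bool) : Prop :=
  ∀ x n, ∀ o : Fin 2, (M.queries O x n).count o ≤ 1

end OracleTM

/-- The class `P^{C:D}`: polynomial time with at most one query to a set in `C` followed by at
most one query to a set in `D`. -/
def POrdered (C D : Set (Language Bool)) : Set (Language Bool) :=
  {L | ∃ A ∈ C, ∃ B ∈ D, ∃ M : OracleTM, M.IsPolyTime ∧ M.OrderedQueries ![A, B] ∧
    L = M.accepts ![A, B]}

/-- The class `P^{C,D}`: polynomial time with at most one query to a set in `C` and at most one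
query to a set in `D`, in arbitrary order. -/
def PAnyOrder (C D : Set (Language Bool)) : Set (Language Bool) :=
  {L | ∃ A ∈ C, ∃ B ∈ D, ∃ M : OracleTM, M.IsPolyTime ∧ M.OnceEachQueries ![A, B] ∧
    L = M.accepts ![A, B]}

/-- The disjoint union `A ⊕ B = {x0 | x ∈ A} ∪ {x1 | x ∈ B}`. -/
def disjointUnion (A B : Language Bool) : Language Bool :=
  {w | (∃ x ∈ A, w = x ++ [false]) ∨ (∃ x ∈ B, w = x ++ [true])}

/-- `C` is closed under disjoint union. -/
def ClosedUnderDisjointUnion (C : Set (Language Bool)) : Prop :=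
  ∀ A ∈ C, ∀ B ∈ C, disjointUnion A B ∈ C

end QueryOrder

/-! Let `M` ask `A` and `B` once each in arbitrary order. Until its first query `M` has received no
answer, so which oracle it addresses first is decided, without any query, by the machine
`firstQuery`; its verdict does not depend on the oracles.

Where `B` comes first, `M` respects the order of `POrdered D C`. Rejecting all other inputs
therefore gives a language in `POrdered D C`, which by hypothesis has a machine `M'` asking some
`A'` in `C` and then some `B'` in `D`. Where `B` does not come first, `M` itself has the required
order.

The final machine decides the case and then runs `M'` or `M`. Closure under disjoint union lets both
share the oracles `A ⊕ A'` and `B ⊕ B'`: a bit appended to each query selects the side. The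
constructions `swap`, `tag`, `firstQuery` and `branch` make this precise; `branch_of_mem` and
`branch_of_not_mem` carry the case distinction. -/

namespace QueryOrder

namespace OracleTM

/-! ### Runs, halting and query lists -/

section Run

variable (M : OracleTM) (O : Fin 2 → Language Bool) (x : List Bool)

theorem run_succ (n : ℕ) : M.run O x (n + 1) = M.step O x (M.run O x n) :=
  Function.iterate_succ_apply' _ _ _

theorem queries_succ (n : ℕ) :
    M.queries O x (n + 1) = M.queries O x n ++ (M.asked x (M.run O x n)).toList := by
  simp only [queries, List.range_succ, List.filterMap_append]
  cases h : M.asked x (M.run O x n) <;> simp [h]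

theorem queries_sublist_of_le {m n : ℕ} (h : m ≤ n) :
    (M.queries O x m).Sublist (M.queries O x n) :=
  (List.range_sublist.2 h).filterMap _

variable {M O x}

theorem step_of_instr_eq_halt {c : M.Cfg} {acc : Bool} (h : M.instr x c = .halt acc) :
    M.step O x c = c := by
  simp [step, h]

theorem run_eq_of_le {n m : ℕ} {acc : Bool} (h : M.instr x (M.run O x n) = .halt acc)
    (hnm : n ≤ m) : M.run O x m = M.run O x n := by
  induction m, hnm using Nat.le_induction with
  | base => rfl
  | succ k _ ih => rw [run_succ, ih, step_of_instr_eq_halt h]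

theorem HaltsIn.mono {n m : ℕ} (h : M.HaltsIn O x n) (hnm : n ≤ m) : M.HaltsIn O x m := by
  obtain ⟨acc, hacc⟩ := h
  exact ⟨acc, by rw [run_eq_of_le hacc hnm, hacc]⟩

theorem mem_accepts_iff_of_halt {n : ℕ} {acc : Bool}
    (h : M.instr x (M.run O x n) = .halt acc) : x ∈ M.accepts O ↔ acc = true := by
  constructor
  · rintro ⟨m, hm⟩
    have h1 := run_eq_of_le h (le_max_left n m)
    have h2 := run_eq_of_le hm (le_max_right n m)
    rw [← h2, h1, h] at hm
    exact Instr.halt.inj hm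
  · rintro rfl
    exact ⟨n, h⟩

/-- Halted configurations are frozen, so acceptance is still visible after any delay `T`. -/
theorem mem_accepts_iff_add (T : ℕ) :
    x ∈ M.accepts O ↔ ∃ n, M.instr x (M.run O x (T + n)) = .halt true := by
  constructor
  · rintro ⟨n, hn⟩
    exact ⟨n, by rw [run_eq_of_le hn (Nat.le_add_left n T), hn]⟩
  · rintro ⟨n, hn⟩
    exact ⟨_, hn⟩

/-- Bounds the time that `branch` needs for rewinding the input head. -/
theorem pos_run_le (n : ℕ) : (M.run O x n).pos ≤ x.length + 1 := by
  induction n with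
  | zero => exact Nat.zero_le _
  | succ n ih =>
    rw [run_succ, step]
    split
    · next inp _ _ _ _ =>
      rcases inp with _ | (_ | _) <;> simp only [moveInput] <;> omega
    · exact ih
    · exact ih

end Run

/-! ### Step-by-step simulation of one machine inside another -/

/-- A way of finding the states, tapes, symbols and oracles of `K` in `N`. -/
structure Embedding (K N : OracleTM) where
  state : K.State → N.State
  tape : K.TapeIdx → N.TapeIdx
  -- Symbols are projected from `N` to `K`, since a symbol of `N` may carry further components;
  -- blanks must go to blanks for tapes to be mapped.
  sym : Turing.PointedMap N.Sym K.Sym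
  oracle : Fin 2 → Fin 2

namespace Embedding

variable {K N : OracleTM} (e : Embedding K N)

/-- An instruction of `N` has the effect of an instruction of `K` on the embedded part. -/
def InstrMatch :
    Instr N.State N.TapeIdx N.Sym → Instr K.State K.TapeIdx K.Sym → Prop
  | .work q inp w d m, .work q' inp' w' d' m' =>
    q = e.state q' ∧ inp = inp' ∧ (∀ i, e.sym (w (e.tape i)) = w' i) ∧
      (∀ i, d (e.tape i) = d' i) ∧ m = m'
  | .ask o y n, .ask o' y' n' => o = e.oracle o' ∧ y = e.state y' ∧ n = e.state n'
  | .halt a, .halt a' => a = a'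
  | _, _ => False

/-- A configuration of `N` represents a configuration of `K`. -/
structure CfgMatch (c : N.Cfg) (c' : K.Cfg) : Prop where
  state : c.state = e.state c'.state
  pos : c.pos = c'.pos
  tapes : ∀ i, (c.tapes (e.tape i)).map e.sym = c'.tapes i
  query : c.query = c'.query

variable {e} {O : Fin 2 → Language Bool} {x : List Bool}

theorem map_moveTape {Γ Γ' : Type} [Inhabited Γ] [Inhabited Γ'] (f : Turing.PointedMap Γ Γ')
    (d : Option Turing.Dir) (T : Turing.Tape Γ) :
    (moveTape d T).map f = moveTape d (T.map f) := by
  cases d with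
  | none => rfl
  | some d => exact Turing.Tape.map_move f T d

theorem CfgMatch.step {c : N.Cfg} {c' : K.Cfg} (hc : e.CfgMatch c c')
    (hi : e.InstrMatch (N.instr x c) (K.instr x c')) :
    e.CfgMatch (N.step O x c) (K.step (O ∘ e.oracle) x c') := by
  rw [OracleTM.step, OracleTM.step]
  generalize N.instr x c = i at hi
  generalize K.instr x c' = i' at hi
  rcases i with ⟨q, inp, w, d, m⟩ | ⟨o, y, n⟩ | a <;>
    rcases i' with ⟨q', inp', w', d', m'⟩ | ⟨o', y', n'⟩ | a' <;> simp only [InstrMatch] at hi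
  · obtain ⟨rfl, rfl, hw, hd, rfl⟩ := hi
    refine ⟨rfl, by simp [hc.pos], fun i => ?_, by simp [hc.query]⟩
    simp only [map_moveTape, Turing.Tape.map_write, hw, hd, hc.tapes]
  · obtain ⟨rfl, rfl, rfl⟩ := hi
    refine ⟨?_, hc.pos, hc.tapes, rfl⟩
    have hq : c.query ∈ O (e.oracle o') ↔ c'.query ∈ O (e.oracle o') := by rw [hc.query]
    by_cases h : c'.query ∈ O (e.oracle o') <;> simp [hq, h]
  · exact hc

/-- `N` acts on the embedded part as `K` does. -/
def Simulates (e : Embedding K N) : Prop :=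
  ∀ q s v, e.InstrMatch (N.trans (e.state q) s v) (K.trans q s fun i => e.sym (v (e.tape i)))

theorem CfgMatch.head {c : N.Cfg} {c' : K.Cfg} (hc : e.CfgMatch c c') (i : K.TapeIdx) :
    (c'.tapes i).head = e.sym (c.tapes (e.tape i)).head := by
  rw [← hc.tapes, Turing.Tape.map_fst]

theorem Simulates.instr (he : e.Simulates) {c : N.Cfg} {c' : K.Cfg} (hc : e.CfgMatch c c') :
    e.InstrMatch (N.instr x c) (K.instr x c') := by
  simp only [OracleTM.instr, hc.head, hc.state, hc.pos]
  exact he _ _ _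

theorem InstrMatch.halt_iff {i : Instr N.State N.TapeIdx N.Sym}
    {i' : Instr K.State K.TapeIdx K.Sym} (h : e.InstrMatch i i') (a : Bool) :
    i = .halt a ↔ i' = .halt a := by
  cases i <;> cases i' <;> simp_all [InstrMatch]

theorem asked_of_instrMatch {c : N.Cfg} {c' : K.Cfg}
    (h : e.InstrMatch (N.instr x c) (K.instr x c')) :
    N.asked x c = (K.asked x c').map e.oracle := by
  rw [asked, asked]
  generalize N.instr x c = i at h
  generalize K.instr x c' = i' at h
  cases i <;> cases i' <;> simp_all [InstrMatch]

variable {T : ℕ}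

/-- The offset `T` leaves room for a preliminary phase of `N` before `K` starts. -/
theorem Simulates.run (he : e.Simulates) (hT : e.CfgMatch (N.run O x T) K.init) (n : ℕ) :
    e.CfgMatch (N.run O x (T + n)) (K.run (O ∘ e.oracle) x n) := by
  induction n with
  | zero => exact hT
  | succ n ih =>
    rw [← add_assoc, run_succ, run_succ]
    exact ih.step (he.instr ih)

theorem Simulates.mem_accepts (he : e.Simulates) (hT : e.CfgMatch (N.run O x T) K.init) :
    x ∈ N.accepts O ↔ x ∈ K.accepts (O ∘ e.oracle) := by
  rw [mem_accepts_iff_add T]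
  exact exists_congr fun n => (he.instr (he.run hT n)).halt_iff true

theorem Simulates.haltsIn (he : e.Simulates) (hT : e.CfgMatch (N.run O x T) K.init) {n : ℕ}
    (hn : K.HaltsIn (O ∘ e.oracle) x n) : N.HaltsIn O x (T + n) := by
  obtain ⟨a, ha⟩ := hn
  exact ⟨a, ((he.instr (he.run hT n)).halt_iff a).2 ha⟩

theorem Simulates.queries (he : e.Simulates) (hT : e.CfgMatch (N.run O x T) K.init)
    (hq : N.queries O x T = []) (n : ℕ) :
    N.queries O x (T + n) = (K.queries (O ∘ e.oracle) x n).map e.oracle := by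
  induction n with
  | zero => exact hq
  | succ n ih =>
    rw [← add_assoc, queries_succ, queries_succ, ih,
      asked_of_instrMatch (he.instr (he.run hT n)), List.map_append]
    cases K.asked x (K.run (O ∘ e.oracle) x n) <;> rfl

/-- Queries made by time `n` are among those made by time `T + n`; a sublist suffices for the query
bounds. -/
theorem Simulates.queries_sublist (he : e.Simulates) (hT : e.CfgMatch (N.run O x T) K.init)
    (hq : N.queries O x T = []) (n : ℕ) :
    (N.queries O x n).Sublist ((K.queries (O ∘ e.oracle) x n).map e.oracle) := by
  rw [← he.queries hT hq]
  exact N.queries_sublist_of_le O x (Nat.le_add_left n T)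

end Embedding

/-! ### Exchanging the two oracles -/

section Swap

variable (M : OracleTM)

/-- `M` with the numbers of the two oracles exchanged. -/
def swap : OracleTM where
  State := M.State
  TapeIdx := M.TapeIdx
  Sym := M.Sym
  start := M.start
  trans q s v := match M.trans q s v with
    | .ask o y n => .ask (Equiv.swap 0 1 o) y n
    | i => i

/-- `M` inside `M.swap`. -/
def swapEmbedding : Embedding M M.swap where
  state := id
  tape := id
  sym := ⟨id, rfl⟩
  oracle := Equiv.swap 0 1

theorem swapEmbedding_simulates : M.swapEmbedding.Simulates := by
  intro q s v
  change M.swapEmbedding.InstrMatch (match M.trans q s v with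
    | .ask o y n => .ask (Equiv.swap 0 1 o) y n
    | i => i) (M.trans q s v)
  cases M.trans q s v
  · exact ⟨rfl, rfl, fun _ => rfl, fun _ => rfl, rfl⟩
  · exact ⟨rfl, rfl, rfl⟩
  · rfl

theorem swapEmbedding_init : M.swapEmbedding.CfgMatch M.swap.init M.init :=
  ⟨rfl, rfl, fun _ => Turing.Tape.map_mk₁ _ [], rfl⟩

variable {M} {O : Fin 2 → Language Bool} {x : List Bool}

theorem mem_accepts_swap : x ∈ M.swap.accepts O ↔ x ∈ M.accepts (O ∘ Equiv.swap 0 1) :=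
  (swapEmbedding_simulates M).mem_accepts (T := 0) (swapEmbedding_init M)

theorem queries_swap_sublist (n : ℕ) :
    (M.swap.queries O x n).Sublist
      ((M.queries (O ∘ Equiv.swap 0 1) x n).map (Equiv.swap 0 1)) :=
  (swapEmbedding_simulates M).queries_sublist (T := 0) (swapEmbedding_init M) rfl n

theorem IsPolyTime.swap (h : M.IsPolyTime) : M.swap.IsPolyTime := by
  obtain ⟨p, hp⟩ := h
  refine ⟨p, fun O x => ?_⟩
  have := (swapEmbedding_simulates M).haltsIn (T := 0) (swapEmbedding_init M)
    (hp (O ∘ Equiv.swap 0 1) x)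
  rwa [Nat.zero_add] at this

end Swap

/-! ### Appending a bit to every query -/

section Tag

variable (M : OracleTM) (b : Bool)

/-- `M` with the bit `b` appended to all queries. Each step of `M` takes two steps. -/
def tag : OracleTM where
  State := M.State × Bool
  TapeIdx := M.TapeIdx
  Sym := M.Sym
  start := (M.start, false)
  trans q s v := match q.2, M.trans q.1 s v with
    | _, .halt acc => .halt acc
    -- Writing back the scanned symbols `v` without moving preserves what `M` sees, so the second
    -- half-step finds the same instruction.
    | false, .work _ _ _ _ _ => .work (q.1, true) none v (fun _ => none) none
    | false, .ask _ _ _ => .work (q.1, true) none v (fun _ => none) (some b)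
    | true, .work q' inp w d m => .work (q', false) inp w d m
    | true, .ask o y n => .ask o (y, false) (n, false)

variable {M b} {O : Fin 2 → Language Bool} {x : List Bool}

/-- The oracles that `M` sees inside `M.tag b`. -/
def untag (b : Bool) (O : Fin 2 → Language Bool) : Fin 2 → Language Bool :=
  fun o => {w | w ++ [b] ∈ O o}

/-- The configuration of `M.tag b` that represents `c`. -/
def tagCfg (b : Bool) (c : M.Cfg) : (M.tag b).Cfg where
  state := (c.state, false)
  pos := c.pos
  tapes := c.tapes
  query := c.query

/-- The configuration of `M.tag b` that represents `c` just before the step of `M`, when the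
string on the query tape has been extended by `m`. -/
def tagMidCfg (b : Bool) (c : M.Cfg) (m : Option Bool) : (M.tag b).Cfg where
  state := (c.state, true)
  pos := c.pos
  tapes := c.tapes
  query := c.query ++ m.toList

theorem step_tagCfg {c : M.Cfg} {m : Option Bool}
    (h : (M.tag b).instr x (tagCfg b c) =
      .work (c.state, true) none (fun i => (c.tapes i).head) (fun _ => none) m) :
    (M.tag b).step O x (tagCfg b c) = tagMidCfg b c m := by
  rw [step, h]
  simp only [tagMidCfg, tagCfg, moveInput, moveTape]
  congr 1

/-- The query `w` of `M` is asked as `w ++ [b]`, which `untag b` undoes, so the answers agree. When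
`M` halts, both half-steps are idle. -/
theorem tag_two_steps (c : M.Cfg) :
    (M.tag b).step O x ((M.tag b).step O x (tagCfg b c)) =
        tagCfg b (M.step (untag b O) x c) ∧
      (M.tag b).asked x (tagCfg b c) = none ∧
      (M.tag b).asked x ((M.tag b).step O x (tagCfg b c)) = M.asked x c := by
  rcases h : M.instr x c with ⟨q', inp, w, d, m⟩ | ⟨o, y, n⟩ | a
  · have h1 : (M.tag b).instr x (tagCfg b c) =
        .work (c.state, true) none (fun i => (c.tapes i).head) (fun _ => none) none := by
      rw [instr] at h
      simp [instr, tag, tagCfg, h]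
    have h2 : (M.tag b).instr x (tagMidCfg b c none) = .work (q', false) inp w d m := by
      rw [instr] at h
      simp [instr, tag, tagMidCfg, h]
    rw [step_tagCfg h1]
    refine ⟨?_, by simp [asked, h1], by simp [asked, h, h2]⟩
    simp only [step, h2, h]
    simp [tagMidCfg, tagCfg]
    rfl
  · have h1 : (M.tag b).instr x (tagCfg b c) =
        .work (c.state, true) none (fun i => (c.tapes i).head) (fun _ => none) (some b) := by
      rw [instr] at h
      simp [instr, tag, tagCfg, h]
    have h2 : (M.tag b).instr x (tagMidCfg b c (some b)) = .ask o (y, false) (n, false) := by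
      rw [instr] at h
      simp [instr, tag, tagMidCfg, h]
    rw [step_tagCfg h1]
    refine ⟨?_, by simp [asked, h1], by simp [asked, h, h2]⟩
    simp only [step, h2, h]
    by_cases hq : c.query ++ [b] ∈ O o
    · have hq' : c.query ∈ untag b O o := hq
      simp [tagMidCfg, tagCfg, hq, hq']
    · have hq' : c.query ∉ untag b O o := hq
      simp [tagMidCfg, tagCfg, hq, hq']
  · have h1 : (M.tag b).instr x (tagCfg b c) = .halt a := by
      rw [instr] at h
      simp [instr, tag, tagCfg, h]
    simp [step_of_instr_eq_halt h1, step_of_instr_eq_halt h, asked, h1, h]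

theorem run_tag (n : ℕ) :
    (M.tag b).run O x (2 * n) = tagCfg b (M.run (untag b O) x n) := by
  induction n with
  | zero => rfl
  | succ n ih =>
    rw [Nat.mul_succ, run_succ, run_succ, ih, (tag_two_steps _).1, run_succ]

theorem instr_tag_halt_iff (c : M.Cfg) (a : Bool) :
    (M.tag b).instr x (tagCfg b c) = .halt a ↔ M.instr x c = .halt a := by
  rcases h : M.trans c.state (inputAt x c.pos) (fun i => (c.tapes i).head) with
    ⟨q', inp, w, d, m⟩ | ⟨o, y, n⟩ | a <;> simp [instr, tag, tagCfg, h]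

theorem mem_accepts_tag : x ∈ (M.tag b).accepts O ↔ x ∈ M.accepts (untag b O) := by
  constructor
  · rintro ⟨n, hn⟩
    refine ⟨n, (instr_tag_halt_iff (b := b) _ _).1 ?_⟩
    -- Time `n` need not correspond to a full step of `M`; halting persists until the even time `2 *
    -- n`.
    rw [← run_tag, run_eq_of_le hn (by omega), hn]
  · rintro ⟨n, hn⟩
    exact ⟨2 * n, by rw [run_tag, instr_tag_halt_iff, hn]⟩

theorem queries_tag (n : ℕ) :
    (M.tag b).queries O x (2 * n) = M.queries (untag b O) x n := by
  induction n with
  | zero => rfl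
  | succ n ih =>
    rw [Nat.mul_succ, queries_succ, queries_succ, queries_succ, ih, run_succ, run_tag,
      (tag_two_steps (O := O) _).2.1, (tag_two_steps _).2.2]
    simp

theorem queries_tag_sublist (n : ℕ) :
    ((M.tag b).queries O x n).Sublist (M.queries (untag b O) x n) := by
  rw [← queries_tag]
  exact queries_sublist_of_le _ O x (by omega)

theorem IsPolyTime.tag (h : M.IsPolyTime) : (M.tag b).IsPolyTime := by
  obtain ⟨p, hp⟩ := h
  refine ⟨2 * p, fun O x => ?_⟩
  obtain ⟨a, ha⟩ := hp (untag b O) x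
  refine ⟨a, ?_⟩
  rw [Polynomial.eval_mul, Polynomial.eval_ofNat, run_tag, instr_tag_halt_iff, ha]

end Tag

/-! ### Branching on a query-free test -/

section Branch

/-- `S` makes no queries and writes nothing on its query tape. -/
def IsSilent (S : OracleTM) : Prop :=
  ∀ q s v, match S.trans q s v with
    | .work _ _ _ _ m => m = none
    | .ask _ _ _ => False
    | .halt _ => True

/-- Only `ask` consults the oracles. Hence a test keeps its meaning when the oracles are replaced.
-/
theorem IsSilent.run_eq {S : OracleTM} (hS : S.IsSilent) (O O' : Fin 2 → Language Bool)
    (x : List Bool) (n : ℕ) : S.run O x n = S.run O' x n := by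
  induction n with
  | zero => rfl
  | succ n ih =>
    rw [run_succ, run_succ, ih, step, step]
    have := hS (S.run O' x n).state (inputAt x (S.run O' x n).pos)
      (fun i => ((S.run O' x n).tapes i).head)
    rw [← instr] at this
    generalize S.instr x (S.run O' x n) = i at this
    cases i <;> simp_all

theorem IsSilent.mem_accepts_iff {S : OracleTM} (hS : S.IsSilent)
    (O O' : Fin 2 → Language Bool) (x : List Bool) : x ∈ S.accepts O ↔ x ∈ S.accepts O' :=
  exists_congr fun n => by rw [hS.run_eq O O']

/-- The states of `branch`. -/
inductive BranchState (Q Q₀ Q₁ : Type) : Type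
  | decide (q : Q)
  | rewind (b : Bool)
  | left (q : Q₀)
  | right (q : Q₁)

instance {Q Q₀ Q₁ : Type} [Finite Q] [Finite Q₀] [Finite Q₁] :
    Finite (BranchState Q Q₀ Q₁) := by
  let f : BranchState Q Q₀ Q₁ → (Q ⊕ Bool) ⊕ (Q₀ ⊕ Q₁)
    | .decide q => .inl (.inl q)
    | .rewind b => .inl (.inr b)
    | .left q => .inr (.inl q)
    | .right q => .inr (.inr q)
  refine Finite.of_injective f ?_
  rintro (_ | _ | _ | _) (_ | _ | _ | _) h <;> simp_all [f]

variable (S K₀ K₁ : OracleTM)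

/-- The instruction of `branch` during the run of `S`. -/
def branchDecide :
    Instr S.State S.TapeIdx S.Sym →
      Instr (BranchState S.State K₀.State K₁.State) (S.TapeIdx ⊕ K₀.TapeIdx ⊕ K₁.TapeIdx)
        (S.Sym × K₀.Sym × K₁.Sym)
  | .work q inp w d m => .work (.decide q) inp
      (Sum.elim (fun i => (w i, default)) fun _ => default) (Sum.elim d fun _ => none) m
  -- Unreachable for silent `S`; the value is arbitrary.
  | .ask _ _ _ => .halt false
  | .halt acc => .work (.rewind acc) none (fun _ => default) (fun _ => none) none

/-- The instruction of `branch` during the run of `K₀`. -/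
def branchLeft :
    Instr K₀.State K₀.TapeIdx K₀.Sym →
      Instr (BranchState S.State K₀.State K₁.State) (S.TapeIdx ⊕ K₀.TapeIdx ⊕ K₁.TapeIdx)
        (S.Sym × K₀.Sym × K₁.Sym)
  | .work q inp w d m => .work (.left q) inp
      (Sum.elim (fun _ => default) (Sum.elim (fun i => (default, w i, default)) fun _ => default))
      (Sum.elim (fun _ => none) (Sum.elim d fun _ => none)) m
  | .ask o y n => .ask o (.left y) (.left n)
  | .halt acc => .halt acc

/-- The instruction of `branch` during the run of `K₁`. -/
def branchRight :
    Instr K₁.State K₁.TapeIdx K₁.Sym →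
      Instr (BranchState S.State K₀.State K₁.State) (S.TapeIdx ⊕ K₀.TapeIdx ⊕ K₁.TapeIdx)
        (S.Sym × K₀.Sym × K₁.Sym)
  | .work q inp w d m => .work (.right q) inp
      (Sum.elim (fun _ => default) (Sum.elim (fun _ => default) fun i => (default, default, w i)))
      (Sum.elim (fun _ => none) (Sum.elim (fun _ => none) d)) m
  | .ask o y n => .ask o (.right y) (.right n)
  | .halt acc => .halt acc

/-- The machine that runs `S`, rewinds the input tape, and then runs `K₁` if `S` has accepted
and `K₀` otherwise. -/
def branch : OracleTM where
  State := BranchState S.State K₀.State K₁.State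
  TapeIdx := S.TapeIdx ⊕ K₀.TapeIdx ⊕ K₁.TapeIdx
  Sym := S.Sym × K₀.Sym × K₁.Sym
  start := .decide S.start
  trans q s v := match q, s with
    | .decide q, s => branchDecide S K₀ K₁ (S.trans q s fun i => (v (.inl i)).1)
    | .rewind b, .left => .work (bif b then .right K₁.start else .left K₀.start) none
        (fun _ => default) (fun _ => none) none
    | .rewind b, _ => .work (.rewind b) (some .left) (fun _ => default) (fun _ => none) none
    | .left q, s => branchLeft S K₀ K₁ (K₀.trans q s fun i => (v (.inr (.inl i))).2.1)
    | .right q, s => branchRight S K₀ K₁ (K₁.trans q s fun i => (v (.inr (.inr i))).2.2)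

/-- `S` inside `branch S K₀ K₁`. -/
def decideEmbedding : Embedding S (branch S K₀ K₁) where
  state := .decide
  tape := .inl
  sym := ⟨Prod.fst, rfl⟩
  oracle := id

/-- `K₀` inside `branch S K₀ K₁`. -/
def leftEmbedding : Embedding K₀ (branch S K₀ K₁) where
  state := .left
  tape := fun i => .inr (.inl i)
  sym := ⟨fun a => a.2.1, rfl⟩
  oracle := id

/-- `K₁` inside `branch S K₀ K₁`. -/
def rightEmbedding : Embedding K₁ (branch S K₀ K₁) where
  state := .right
  tape := fun i => .inr (.inr i)
  sym := ⟨fun a => a.2.2, rfl⟩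
  oracle := id

theorem leftEmbedding_simulates : (leftEmbedding S K₀ K₁).Simulates := by
  intro q s v
  change (leftEmbedding S K₀ K₁).InstrMatch
    (branchLeft S K₀ K₁ (K₀.trans q s fun i => (v (.inr (.inl i))).2.1))
    (K₀.trans q s fun i => (v (.inr (.inl i))).2.1)
  cases K₀.trans q s fun i => (v (.inr (.inl i))).2.1
  · exact ⟨rfl, rfl, fun _ => rfl, fun _ => rfl, rfl⟩
  · exact ⟨rfl, rfl, rfl⟩
  · rfl

theorem rightEmbedding_simulates : (rightEmbedding S K₀ K₁).Simulates := by
  intro q s v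
  change (rightEmbedding S K₀ K₁).InstrMatch
    (branchRight S K₀ K₁ (K₁.trans q s fun i => (v (.inr (.inr i))).2.2))
    (K₁.trans q s fun i => (v (.inr (.inr i))).2.2)
  cases K₁.trans q s fun i => (v (.inr (.inr i))).2.2
  · exact ⟨rfl, rfl, fun _ => rfl, fun _ => rfl, rfl⟩
  · exact ⟨rfl, rfl, rfl⟩
  · rfl

variable {S K₀ K₁} {O : Fin 2 → Language Bool} {x : List Bool}

theorem instr_branch_decide {c : (branch S K₀ K₁).Cfg} {c' : S.Cfg}
    (hc : (decideEmbedding S K₀ K₁).CfgMatch c c') :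
    (branch S K₀ K₁).instr x c = branchDecide S K₀ K₁ (S.instr x c') := by
  simp only [instr, hc.head, hc.state, hc.pos]
  rfl

/-- The part of the tapes that `K₀` and `K₁` use is blank. -/
def FreshTapes (c : (branch S K₀ K₁).Cfg) : Prop :=
  ∀ i, c.tapes (.inr i) = default

/-- `decideEmbedding` is not a full simulation: when `S` halts, `branch` goes on to rewind. The
invariant is therefore kept only up to the first halt. Silence keeps the query tape empty, and
blanks written over blanks keep the other tapes fresh. -/
theorem branch_run_decide (hS : S.IsSilent) (n : ℕ)
    (hn : ∀ m < n, ∀ a, S.instr x (S.run O x m) ≠ .halt a) :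
    (decideEmbedding S K₀ K₁).CfgMatch ((branch S K₀ K₁).run O x n) (S.run O x n) ∧
      FreshTapes ((branch S K₀ K₁).run O x n) ∧ (S.run O x n).query = [] ∧
      (branch S K₀ K₁).queries O x n = [] := by
  induction n with
  | zero =>
    exact ⟨⟨rfl, rfl, fun _ => Turing.Tape.map_mk₁ _ [], rfl⟩, fun _ => rfl, rfl, rfl⟩
  | succ n ih =>
    obtain ⟨hc, ht, hq, hqs⟩ := ih fun m hm => hn m (hm.trans n.lt_succ_self)
    have hi := instr_branch_decide (x := x) hc
    have hs := hS (S.run O x n).state (inputAt x (S.run O x n).pos)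
      (fun i => ((S.run O x n).tapes i).head)
    rw [← instr] at hs
    have hh := hn n n.lt_succ_self
    rcases h : S.instr x (S.run O x n) with ⟨q, inp, w, d, m⟩ | ⟨o, y, z⟩ | a
    · rw [h] at hi hs
      obtain rfl : m = none := hs
      refine ⟨?_, fun i => ?_, ?_, ?_⟩
      · rw [run_succ, run_succ]
        refine hc.step (O := O) ?_
        rw [hi, h]
        exact ⟨rfl, rfl, fun _ => rfl, fun _ => rfl, rfl⟩
      · rw [run_succ, step, hi]
        simp only [branchDecide]
        rw [ht]
        rfl
      · rw [run_succ, step, h]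
        simp [hq]
      · rw [queries_succ, hqs, asked, hi]
        rfl
    · rw [h] at hs
      exact hs.elim
    · exact absurd h (hh a)

/-- `branch` is rewinding the input tape with the head at `p`. -/
structure Rewinding (b : Bool) (p : ℕ) (c : (branch S K₀ K₁).Cfg) : Prop where
  state : c.state = .rewind b
  pos : c.pos = p
  tapes : FreshTapes c
  query : c.query = []

theorem rewinding_of_decide {c : (branch S K₀ K₁).Cfg} {c' : S.Cfg} {a : Bool}
    (hc : (decideEmbedding S K₀ K₁).CfgMatch c c') (ht : FreshTapes c) (hq : c'.query = [])
    (h : S.instr x c' = .halt a) :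
    Rewinding a c'.pos ((branch S K₀ K₁).step O x c) ∧ (branch S K₀ K₁).asked x c = none := by
  have hi := instr_branch_decide (x := x) hc
  rw [h] at hi
  rw [step, asked, hi]
  refine ⟨⟨rfl, hc.pos, fun i => ?_, ?_⟩, rfl⟩
  · simp only [branchDecide]
    rw [ht]
    rfl
  · simp [branchDecide, hc.query, hq]

theorem Rewinding.step {b : Bool} {p : ℕ} {c : (branch S K₀ K₁).Cfg}
    (hc : Rewinding b (p + 1) c) :
    Rewinding b p ((branch S K₀ K₁).step O x c) ∧ (branch S K₀ K₁).asked x c = none := by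
  have hi : (branch S K₀ K₁).instr x c =
      .work (.rewind b) (some .left) (fun _ => default) (fun _ => none) none := by
    rw [instr, hc.state, hc.pos, inputAt]
    cases x[p]? <;> rfl
  rw [OracleTM.step, asked, hi]
  refine ⟨⟨rfl, by simp [moveInput, hc.pos], fun i => ?_, by simp [hc.query]⟩, rfl⟩
  change moveTape none ((c.tapes (.inr i)).write default) = default
  rw [hc.tapes]
  rfl

theorem Rewinding.run {b : Bool} {p t : ℕ}
    (hc : Rewinding b p ((branch S K₀ K₁).run O x t))
    (hq : (branch S K₀ K₁).queries O x t = []) :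
    Rewinding b 0 ((branch S K₀ K₁).run O x (t + p)) ∧
      (branch S K₀ K₁).queries O x (t + p) = [] := by
  induction p generalizing t with
  | zero => exact ⟨hc, hq⟩
  | succ p ih =>
    rw [Nat.add_comm p, ← add_assoc]
    refine ih ?_ ?_
    · rw [run_succ]
      exact hc.step.1
    · rw [queries_succ, hq, (hc.step (O := O)).2]
      rfl

theorem Rewinding.start {b : Bool} {c : (branch S K₀ K₁).Cfg} (hc : Rewinding b 0 c) :
    (branch S K₀ K₁).asked x c = none ∧
      (b = false → (leftEmbedding S K₀ K₁).CfgMatch ((branch S K₀ K₁).step O x c) K₀.init) ∧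
      (b = true → (rightEmbedding S K₀ K₁).CfgMatch ((branch S K₀ K₁).step O x c) K₁.init) := by
  have hi : (branch S K₀ K₁).instr x c =
      .work (bif b then .right K₁.start else .left K₀.start) none
        (fun _ => default) (fun _ => none) none := by
    rw [instr, hc.state, hc.pos]
    rfl
  have ht : ∀ i, moveTape none ((c.tapes (.inr i)).write default) = default := by
    intro i
    rw [hc.tapes]
    rfl
  rw [OracleTM.step, asked, hi]
  refine ⟨rfl, ?_, ?_⟩
  · rintro rfl
    refine ⟨rfl, hc.pos, fun i => ?_, by simp [hc.query, init]⟩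
    exact (congrArg _ (ht (.inl i))).trans (Turing.Tape.map_mk₁ _ [])
  · rintro rfl
    refine ⟨rfl, hc.pos, fun i => ?_, by simp [hc.query, init]⟩
    exact (congrArg _ (ht (.inr i))).trans (Turing.Tape.map_mk₁ _ [])

theorem exists_branch_start (hS : S.IsSilent) {N : ℕ} (hN : S.HaltsIn O x N) :
    ∃ T ≤ N + x.length + 3, (branch S K₀ K₁).queries O x T = [] ∧
      (x ∉ S.accepts O →
        (leftEmbedding S K₀ K₁).CfgMatch ((branch S K₀ K₁).run O x T) K₀.init) ∧
      (x ∈ S.accepts O →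
        (rightEmbedding S K₀ K₁).CfgMatch ((branch S K₀ K₁).run O x T) K₁.init) := by
  classical
  have hex : ∃ n, S.HaltsIn O x n := ⟨N, hN⟩
  -- The first halting time, as `branch_run_decide` requires.
  set t := Nat.find hex
  have htN : t ≤ N := Nat.find_min' hex hN
  obtain ⟨a, ha⟩ : S.HaltsIn O x t := Nat.find_spec hex
  obtain ⟨hc, hf, hq, hqs⟩ := branch_run_decide (K₀ := K₀) (K₁ := K₁) hS t
    fun m hm a h => Nat.find_min hex hm ⟨a, h⟩
  obtain ⟨hr, has⟩ := rewinding_of_decide (O := O) hc hf hq ha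
  rw [← run_succ] at hr
  obtain ⟨hr, hqs⟩ := hr.run (by rw [queries_succ, hqs, has]; rfl)
  obtain ⟨hn, h₀, h₁⟩ := hr.start (O := O) (x := x)
  have hp : (S.run O x t).pos ≤ x.length + 1 := pos_run_le t
  have hacc := mem_accepts_iff_of_halt ha
  -- The test takes `t` steps, entering the rewinding state one, rewinding at most `x.length + 1`,
  -- and starting the chosen machine one.
  refine ⟨t + 1 + (S.run O x t).pos + 1, by omega, by rw [queries_succ, hqs, hn]; rfl, ?_, ?_⟩
  · intro h
    rw [run_succ]
    exact h₀ (by simpa [hacc] using h)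
  · intro h
    rw [run_succ]
    exact h₁ (hacc.1 h)

theorem branch_of_not_mem (hS : S.IsSilent) (hp : S.IsPolyTime) (h : x ∉ S.accepts O) :
    (x ∈ (branch S K₀ K₁).accepts O ↔ x ∈ K₀.accepts O) ∧
      ∀ n, ((branch S K₀ K₁).queries O x n).Sublist (K₀.queries O x n) := by
  obtain ⟨p, hp⟩ := hp
  obtain ⟨T, -, hq, hT, -⟩ := exists_branch_start (K₀ := K₀) (K₁ := K₁) hS (hp O x)
  refine ⟨(leftEmbedding_simulates S K₀ K₁).mem_accepts (hT h), fun n => ?_⟩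
  simpa [leftEmbedding] using
    (leftEmbedding_simulates S K₀ K₁).queries_sublist (hT h) hq n

theorem branch_of_mem (hS : S.IsSilent) (hp : S.IsPolyTime) (h : x ∈ S.accepts O) :
    (x ∈ (branch S K₀ K₁).accepts O ↔ x ∈ K₁.accepts O) ∧
      ∀ n, ((branch S K₀ K₁).queries O x n).Sublist (K₁.queries O x n) := by
  obtain ⟨p, hp⟩ := hp
  obtain ⟨T, -, hq, -, hT⟩ := exists_branch_start (K₀ := K₀) (K₁ := K₁) hS (hp O x)
  refine ⟨(rightEmbedding_simulates S K₀ K₁).mem_accepts (hT h), fun n => ?_⟩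
  simpa [rightEmbedding] using
    (rightEmbedding_simulates S K₀ K₁).queries_sublist (hT h) hq n

theorem IsPolyTime.branch (hS : S.IsSilent) (hp : S.IsPolyTime) (h₀ : K₀.IsPolyTime)
    (h₁ : K₁.IsPolyTime) : (branch S K₀ K₁).IsPolyTime := by
  obtain ⟨p, hp⟩ := hp
  obtain ⟨p₀, h₀⟩ := h₀
  obtain ⟨p₁, h₁⟩ := h₁
  refine ⟨p + Polynomial.X + 3 + p₀ + p₁, fun O x => ?_⟩
  obtain ⟨T, hT, -, hT₀, hT₁⟩ := exists_branch_start (K₀ := K₀) (K₁ := K₁) hS (hp O x)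
  simp only [Polynomial.eval_add, Polynomial.eval_X, Polynomial.eval_ofNat]
  by_cases h : x ∈ S.accepts O
  · exact ((rightEmbedding_simulates S K₀ K₁).haltsIn (hT₁ h) (h₁ O x)).mono (by omega)
  · exact ((leftEmbedding_simulates S K₀ K₁).haltsIn (hT₀ h) (h₀ O x)).mono (by omega)

end Branch

/-! ### Determining the first oracle queried -/

section FirstQuery

variable (M : OracleTM)

/-- The machine that runs `M` up to the first query and accepts iff there is one and it goes to
oracle `1`. -/
def firstQuery : OracleTM where
  State := M.State
  TapeIdx := M.TapeIdx
  Sym := M.Sym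
  start := M.start
  trans q s v := match M.trans q s v with
    | .work q inp w d _ => .work q inp w d none
    | .ask o _ _ => .halt (o == 1)
    | .halt _ => .halt false

theorem firstQuery_isSilent : M.firstQuery.IsSilent := by
  intro q s v
  cases h : M.trans q s v <;> simp [firstQuery, h]

/-- The configuration of `M.firstQuery` that represents `c`. -/
def firstQueryCfg (c : M.Cfg) : M.firstQuery.Cfg where
  state := c.state
  pos := c.pos
  tapes := c.tapes
  query := []

variable {M} {O : Fin 2 → Language Bool} {x : List Bool}

/-- Without a query the two machines differ only in the query tape, even if `M` has halted; at the
first query `firstQuery` halts with its verdict and stays there. -/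
theorem firstQuery_run (n : ℕ) :
    (M.queries O x n = [] ∧ M.firstQuery.run O x n = M.firstQueryCfg (M.run O x n)) ∨
      ∃ o l, M.queries O x n = o :: l ∧
        M.firstQuery.instr x (M.firstQuery.run O x n) = .halt (o == 1) := by
  induction n with
  | zero => exact .inl ⟨rfl, rfl⟩
  | succ n ih =>
    rw [queries_succ, run_succ, run_succ]
    rcases ih with ⟨hq, hr⟩ | ⟨o, l, hq, hh⟩
    · rw [hq, hr]
      rcases h : M.instr x (M.run O x n) with ⟨q, inp, w, d, m⟩ | ⟨o, y, z⟩ | a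
      · have h' : M.firstQuery.instr x (M.firstQueryCfg (M.run O x n)) =
            .work q inp w d none := by
          rw [instr] at h
          simp [instr, firstQuery, firstQueryCfg, h]
        refine .inl ⟨by simp [asked, h], ?_⟩
        simp only [step, h, h']
        simp [firstQueryCfg]
        rfl
      · have h' : M.firstQuery.instr x (M.firstQueryCfg (M.run O x n)) = .halt (o == 1) := by
          rw [instr] at h
          simp [instr, firstQuery, firstQueryCfg, h]
        exact .inr ⟨o, [], by simp [asked, h], by rw [step_of_instr_eq_halt h', h']⟩
      · have h' : M.firstQuery.instr x (M.firstQueryCfg (M.run O x n)) = .halt false := by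
          rw [instr] at h
          simp [instr, firstQuery, firstQueryCfg, h]
        refine .inl ⟨by simp [asked, h], ?_⟩
        rw [step_of_instr_eq_halt h, step_of_instr_eq_halt h']
    · exact .inr ⟨o, _, by rw [hq, List.cons_append], by rw [step_of_instr_eq_halt hh, hh]⟩

theorem IsPolyTime.firstQuery (h : M.IsPolyTime) : M.firstQuery.IsPolyTime := by
  obtain ⟨p, hp⟩ := h
  refine ⟨p, fun O x => ?_⟩
  obtain ⟨a, ha⟩ := hp O x
  rcases firstQuery_run (M := M) (O := O) (x := x) (p.eval x.length) with ⟨-, hr⟩ | ⟨o, l, -, hh⟩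
  · refine ⟨false, ?_⟩
    rw [hr]
    rw [instr] at ha
    simp [instr, OracleTM.firstQuery, firstQueryCfg, ha]
  · exact ⟨_, hh⟩

theorem queries_eq_nil_or_cons (n : ℕ) :
    M.queries O x n = [] ∨
      ∃ o l, M.queries O x n = o :: l ∧ (x ∈ M.firstQuery.accepts O ↔ o = 1) := by
  rcases firstQuery_run (M := M) (O := O) (x := x) n with ⟨hq, -⟩ | ⟨o, l, hq, hh⟩
  · exact .inl hq
  · exact .inr ⟨o, l, hq, by rw [mem_accepts_iff_of_halt hh, beq_iff_eq]⟩

/-- A list of oracle numbers without repetition has at most two entries, and the second can only be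
the other oracle. -/
theorem cons_sublist_of_count_le_one {o : Fin 2} {l : List (Fin 2)}
    (h : ∀ o', (o :: l).count o' ≤ 1) : (o :: l).Sublist [o, Equiv.swap 0 1 o] := by
  have hnd : (o :: l).Nodup := List.nodup_iff_count_le_one.2 h
  refine List.Sublist.cons_cons o ?_
  rcases l with _ | ⟨a, _ | ⟨b, l⟩⟩
  · exact List.nil_sublist _
  · have : a = Equiv.swap 0 1 o := by
      simp only [List.nodup_cons, List.mem_singleton] at hnd
      have := hnd.1
      revert o a
      decide
    rw [this]
  · exact absurd hnd.length_le_card (by simp)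

theorem OnceEachQueries.sublist_of_mem (h : M.OnceEachQueries O)
    (hx : x ∈ M.firstQuery.accepts O) (n : ℕ) : (M.queries O x n).Sublist [1, 0] := by
  rcases queries_eq_nil_or_cons (M := M) (O := O) (x := x) n with hq | ⟨o, l, hq, ho⟩
  · simp [hq]
  · have hl := h x n
    rw [hq] at hl ⊢
    obtain rfl := ho.1 hx
    simpa using cons_sublist_of_count_le_one hl

theorem OnceEachQueries.sublist_of_not_mem (h : M.OnceEachQueries O)
    (hx : x ∉ M.firstQuery.accepts O) (n : ℕ) : (M.queries O x n).Sublist [0, 1] := by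
  rcases queries_eq_nil_or_cons (M := M) (O := O) (x := x) n with hq | ⟨o, l, hq, ho⟩
  · simp [hq]
  · have hl := h x n
    rw [hq] at hl ⊢
    obtain rfl : o = 0 := by
      have : o ≠ 1 := fun h => hx (ho.2 h)
      omega
    simpa using cons_sublist_of_count_le_one hl

end FirstQuery

/-- The machine that rejects at once. -/
def reject : OracleTM where
  State := Unit
  TapeIdx := Empty
  Sym := Unit
  start := ()
  trans _ _ _ := .halt false

theorem reject_isPolyTime : reject.IsPolyTime :=
  ⟨0, fun _ _ => ⟨false, rfl⟩⟩

theorem reject_accepts (O : Fin 2 → Language Bool) (x : List Bool) : x ∉ reject.accepts O := by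
  rintro ⟨n, hn⟩
  cases hn

theorem reject_queries (O : Fin 2 → Language Bool) (x : List Bool) (n : ℕ) :
    reject.queries O x n = [] := by
  induction n with
  | zero => rfl
  | succ n ih => rw [queries_succ, ih]; rfl

end OracleTM

/-! ### Disjoint unions and assembly of the final machine -/

open OracleTM

/-- The last bit separates the two sides, so the tagged machine sees exactly its original oracles,
the only ones for which its query bound is known. -/
theorem untag_false_disjointUnion (A A' B B' : Language Bool) :
    untag false ![disjointUnion A A', disjointUnion B B'] = ![A, B] := by
  funext o
  ext w
  fin_cases o
  · change ((∃ y ∈ A, w ++ [false] = y ++ [false]) ∨ ∃ y ∈ A', w ++ [false] = y ++ [true]) ↔ w ∈ A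
    simp
  · change ((∃ y ∈ B, w ++ [false] = y ++ [false]) ∨ ∃ y ∈ B', w ++ [false] = y ++ [true]) ↔ w ∈ B
    simp

theorem untag_true_disjointUnion (A A' B B' : Language Bool) :
    untag true ![disjointUnion A A', disjointUnion B B'] = ![A', B'] := by
  funext o
  ext w
  fin_cases o
  · change ((∃ y ∈ A, w ++ [true] = y ++ [false]) ∨ ∃ y ∈ A', w ++ [true] = y ++ [true]) ↔ w ∈ A'
    simp
  · change ((∃ y ∈ B, w ++ [true] = y ++ [false]) ∨ ∃ y ∈ B', w ++ [true] = y ++ [true]) ↔ w ∈ B'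
    simp

theorem POrdered_subset_PAnyOrder (C D : Set (Language Bool)) :
    POrdered C D ⊆ PAnyOrder C D := by
  rintro L ⟨A, hA, B, hB, M, hM, hq, rfl⟩
  refine ⟨A, hA, B, hB, M, hM, fun x n o => ((hq x n).count_le o).trans ?_, rfl⟩
  revert o
  decide

/-- The strings in the language of `M` on which the first query goes to the second oracle can be
decided with the queries in the other order. -/
theorem accepts_inter_firstQuery_mem_POrdered {C D : Set (Language Bool)} {A B : Language Bool}
    (hA : A ∈ C) (hB : B ∈ D) {M : OracleTM} (hM : M.IsPolyTime)
    (hq : M.OnceEachQueries ![A, B]) :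
    ({x | x ∈ M.firstQuery.accepts ![A, B] ∧ x ∈ M.accepts ![A, B]} : Language Bool) ∈
      POrdered D C := by
  have hO : (![B, A] : Fin 2 → Language Bool) ∘ Equiv.swap 0 1 = ![A, B] := by
    funext o
    fin_cases o <;> rfl
  have hS := M.firstQuery_isSilent
  refine ⟨B, hB, A, hA, branch M.firstQuery reject M.swap,
    .branch hS hM.firstQuery reject_isPolyTime hM.swap, fun x n => ?_, ?_⟩
  · by_cases hx : x ∈ M.firstQuery.accepts ![B, A]
    · refine ((branch_of_mem hS hM.firstQuery hx).2 n).trans ((queries_swap_sublist n).trans ?_)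
      rw [hO]
      -- Exchanging the oracle numbers turns the order `[1, 0]` of `M` into `[0, 1]`.
      exact (hq.sublist_of_mem ((hS.mem_accepts_iff _ _ x).1 hx) n).map _
    · refine ((branch_of_not_mem hS hM.firstQuery hx).2 n).trans ?_
      rw [reject_queries]
      exact List.nil_sublist _
  · ext x
    change _ ∧ _ ↔ _
    rw [hS.mem_accepts_iff _ ![B, A]]
    by_cases hx : x ∈ M.firstQuery.accepts ![B, A]
    · rw [(branch_of_mem hS hM.firstQuery hx).1, mem_accepts_swap, hO]
      exact and_iff_right hx
    · rw [(branch_of_not_mem hS hM.firstQuery hx).1]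
      exact iff_of_false (fun h => hx h.1) (reject_accepts _ x)

end QueryOrder

open QueryOrder OracleTM in
theorem theoremt (C D : Set (Language Bool))
    (hC : QueryOrder.ClosedUnderDisjointUnion C) (hD : QueryOrder.ClosedUnderDisjointUnion D)
    (h : QueryOrder.POrdered C D = QueryOrder.POrdered D C) :
    QueryOrder.POrdered C D = QueryOrder.PAnyOrder C D := by
  refine (POrdered_subset_PAnyOrder C D).antisymm ?_
  rintro L ⟨A, hA, B, hB, M, hM, hq, rfl⟩
  have hL := accepts_inter_firstQuery_mem_POrdered hA hB hM hq
  rw [← h] at hL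
  obtain ⟨A', hA', B', hB', M', hM', hq', hL⟩ := hL
  have hS := M.firstQuery_isSilent
  have hmem (x : List Bool) : (x ∈ M.firstQuery.accepts ![A, B] ∧ x ∈ M.accepts ![A, B]) ↔
      x ∈ M'.accepts ![A', B'] := by
    rw [← hL]
    rfl
  -- The tag `false` gives `M` the oracles `A`, `B`; the tag `true` gives `M'` the oracles `A'`,
  -- `B'`.
  refine ⟨_, hC A hA A' hA', _, hD B hB B' hB', branch M.firstQuery (M.tag false) (M'.tag true),
    .branch hS hM.firstQuery hM.tag hM'.tag, fun x n => ?_, ?_⟩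
  · by_cases hx : x ∈ M.firstQuery.accepts ![disjointUnion A A', disjointUnion B B']
    · refine ((branch_of_mem hS hM.firstQuery hx).2 n).trans ((queries_tag_sublist n).trans ?_)
      rw [untag_true_disjointUnion]
      exact hq' x n
    · refine ((branch_of_not_mem hS hM.firstQuery hx).2 n).trans
        ((queries_tag_sublist n).trans ?_)
      rw [untag_false_disjointUnion]
      exact hq.sublist_of_not_mem (fun hx' => hx ((hS.mem_accepts_iff _ _ x).1 hx')) n
  · ext x
    by_cases hx : x ∈ M.firstQuery.accepts ![disjointUnion A A', disjointUnion B B']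
    -- On inputs passing the test, the language of `M'` coincides with that of `M`.
    · rw [(branch_of_mem hS hM.firstQuery hx).1, mem_accepts_tag, untag_true_disjointUnion,
        ← hmem, and_iff_right ((hS.mem_accepts_iff _ _ x).1 hx)]
    · rw [(branch_of_not_mem hS hM.firstQuery hx).1, mem_accepts_tag, untag_false_disjointUnion]
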